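/- All rings are commutative with identity. An integral domain $R$ is a Bezout domain if every finitely generated ideal of $R$ is principal. An element $a\in R$ is a Gelfand element if for all $b,c\in R$ with $bR+cR+aR=R$ there are $r,s\in R$ with $a=rs$, $rR+bR=R$ and $sR+cR=R$. A local Gelfand domain is a Bezout domain $R$ such that for all $a,b\in R$ with $aR+bR=R$ at least one of $a$, $b$ is a Gelfand element. A ring $R$ is an elementary divisor ring if for every $m\times n$ matrix $A$ over $R$ (all $m,n$) there are invertible matrices $P\in R^{m\times m}$, $Q\in R^{n\times n}$ such that $PAQ$ is diagonal with each diagonal entry dividing the next one. Theorem. Every local Gelfand domain is an elementary divisor ring. -/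

import Mathlib

/-- An element `a` of a commutative ring `R` is a Gelfand element if for all `b, c` with
`bR + cR + aR = R` one can write `a = r s` with `rR + bR = R` and `sR + cR = R`. -/
def IsGelfandElement {R : Type*} [CommRing R] (a : R) : Prop :=
  ∀ b c : R, Ideal.span {b, c, a} = (⊤ : Ideal R) →
    ∃ r s : R, a = r * s ∧ Ideal.span {r, b} = (⊤ : Ideal R) ∧ Ideal.span {s, c} = (⊤ : Ideal R)

/-- A local Gelfand ring: a commutative Bezout ring in which, whenever `aR + bR = R`, at least one
of `a`, `b` is a Gelfand element. -/
structure IsLocalGelfandRing (R : Type*) [CommRing R] : Prop where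
  isBezout : IsBezout R
  gelfand : ∀ a b : R, Ideal.span {a, b} = (⊤ : Ideal R) → IsGelfandElement a ∨ IsGelfandElement b

/-- The `m × n` matrix with diagonal entries `d 0, d 1, …` and all other entries zero. -/
def rectDiagonal {R : Type*} [CommRing R] (m n : ℕ) (d : ℕ → R) : Matrix (Fin m) (Fin n) R :=
  Matrix.of fun i j => if (i : ℕ) = (j : ℕ) then d i else 0

/-- A matrix `A` admits diagonal reduction if there are invertible `P`, `Q` such that `P A Q` is
diagonal, each diagonal entry dividing the next one. (The sequence `d` may be continued by zeros
beyond the last diagonal entry.) -/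
def AdmitsDiagonalReduction {R : Type*} [CommRing R] {m n : ℕ}
    (A : Matrix (Fin m) (Fin n) R) : Prop :=
  ∃ (P : Matrix (Fin m) (Fin m) R) (Q : Matrix (Fin n) (Fin n) R) (d : ℕ → R),
    IsUnit P ∧ IsUnit Q ∧ (∀ i, d i ∣ d (i + 1)) ∧ P * A * Q = rectDiagonal m n d

/-- An elementary divisor ring (Kaplansky): every matrix of every size admits diagonal
reduction. -/
def IsElementaryDivisorRing (R : Type*) [CommRing R] : Prop :=
  ∀ (m n : ℕ) (A : Matrix (Fin m) (Fin n) R), AdmitsDiagonalReduction A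

/-! Everything rests on one 2 × 2 fact (`IsLocalGelfandRing.exists_bilin_dvd`): a bilinear form on
`R²` takes the gcd of its coefficients as a value. Bezout column operations make the form
triangular, and after division by the gcd a Gelfand factorisation of the off-diagonal coefficient
yields the value `1`; the local Gelfand condition provides such a coefficient up to elementary
operations. Passing from two vectors to finitely generated submodules, the image of any `f : Rⁿ →
Rᵐ` contains some `f v` with a functional `φ` such that `g = φ (f v)` divides every entry of `f`. If
`g ≠ 0`, then `f / g` splits as `1 ⊕ f₁`, and induction applies to `f₁`. -/

/-! ### Coprime pairs and bilinear forms on `R²`. -/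

theorem Ideal.span_pair_eq_top_iff_isCoprime {R : Type*} [CommRing R] {a b : R} :
    Ideal.span {a, b} = (⊤ : Ideal R) ↔ IsCoprime a b := by
  rw [Ideal.eq_top_iff_one, Ideal.mem_span_pair]
  rfl

theorem IsBezout.exists_eq_mul_isCoprime {R : Type*} [CommRing R] [IsDomain R] [IsBezout R]
    (a b : R) : ∃ g a' b' : R, a = g * a' ∧ b = g * b' ∧ IsCoprime a' b' := by
  obtain ⟨g, hg⟩ := (IsBezout.span_pair_isPrincipal a b).principal
  have hg' : Ideal.span {a, b} = Ideal.span {g} := hg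
  obtain ⟨a', ha⟩ := Ideal.mem_span_singleton.1 (hg' ▸ Ideal.subset_span (by simp) : a ∈ _)
  obtain ⟨b', hb⟩ := Ideal.mem_span_singleton.1 (hg' ▸ Ideal.subset_span (by simp) : b ∈ _)
  by_cases h0 : g = 0
  · exact ⟨0, 1, 1, by simp [ha, h0], by simp [hb, h0], isCoprime_one_left⟩
  · obtain ⟨u, v, huv⟩ := Ideal.mem_span_pair.1
      (hg'.symm ▸ Ideal.mem_span_singleton_self g : g ∈ Ideal.span {a, b})
    refine ⟨g, a', b', ha, hb, u, v, mul_left_cancel₀ h0 ?_⟩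
    linear_combination huv - u * ha - v * hb

/-- A unimodular triangular matrix with rows `(a, b)`, `(0, c)` represents `1` as a bilinear form
when `b` is a Gelfand element. -/
theorem IsGelfandElement.exists_bilin_eq_one {R : Type*} [CommRing R] [IsDomain R] [IsBezout R]
    {a b c : R} (hb : IsGelfandElement b) (h : Ideal.span {a, c, b} = (⊤ : Ideal R)) :
    ∃ p q x y : R, p * (a * x + b * y) + q * (c * y) = 1 := by
  obtain ⟨r, s, hrs, hr, hs⟩ := hb a c h
  rw [Ideal.span_pair_eq_top_iff_isCoprime] at hr hs
  obtain ⟨t, k, htk⟩ := hs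
  -- Removing the common factor `d` makes `y` coprime to `q`, while `d * (b * y + c * q) = r * (t *
  -- s + k * c) = r`. Hence `b * y + c * q` divides `r` and is coprime to `a`; it is also coprime to
  -- `y`, because `c` and `q` are.
  obtain ⟨d, y, q, hy, hq, hyq⟩ := IsBezout.exists_eq_mul_isCoprime t (r * k)
  have hval : r = d * (b * y + c * q) := by
    linear_combination (-r) * htk - t * hrs + b * hy + c * hq
  have h1 : IsCoprime (b * y + c * q) a := by
    rw [hval] at hr
    exact hr.of_mul_left_right
  have hyc : IsCoprime y c := ⟨s * d, k, by linear_combination htk - s * hy⟩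
  have h2 : IsCoprime (b * y + c * q) y := by
    have := (hyc.mul_right hyq).symm
    rwa [add_comm, IsCoprime.add_mul_right_left_iff]
  obtain ⟨u, v, huv⟩ := h1.mul_right h2
  exact ⟨y, q, v, u, by linear_combination huv⟩

/-- In a local Gelfand domain the coefficient `b` of a unimodular triangular matrix can be changed
by a multiple of `gcd a c` so that it becomes a Gelfand element. -/
theorem IsLocalGelfandRing.exists_triangular_bilin_eq_one {R : Type*} [CommRing R] [IsDomain R]
    (hR : IsLocalGelfandRing R) {a b c : R} (h : Ideal.span {a, c, b} = (⊤ : Ideal R)) :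
    ∃ p q x y : R, p * (a * x + b * y) + q * (c * y) = 1 := by
  have := hR.isBezout
  obtain ⟨e, a', c', ha, hc, α, γ, hαγ⟩ := IsBezout.exists_eq_mul_isCoprime a c
  rw [Ideal.eq_top_iff_one, Ideal.span, Submodule.mem_span_triple] at h
  obtain ⟨u, v, w, huvw⟩ := h
  simp only [smul_eq_mul] at huvw
  -- Here `e = α * a + γ * c` is a gcd of `a` and `c`, so unimodularity says that `b` and `e` are
  -- coprime.
  have hcop : Ideal.span {b, b + e} = (⊤ : Ideal R) := by
    rw [Ideal.span_pair_eq_top_iff_isCoprime]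
    exact ⟨w - (u * a' + v * c'), u * a' + v * c', by
      linear_combination huvw - u * ha - v * hc⟩
  rcases hR.gelfand _ _ hcop with hg | hg
  · refine hg.exists_bilin_eq_one ?_
    rw [Ideal.eq_top_iff_one, Ideal.span, Submodule.mem_span_triple]
    exact ⟨u, v, w, huvw⟩
  · obtain ⟨p, q, x, y, hxy⟩ := hg.exists_bilin_eq_one (a := a) (c := c) (by
      rw [Ideal.eq_top_iff_one, Ideal.span, Submodule.mem_span_triple]
      refine ⟨u - w * α, v - w * γ, w, ?_⟩
      simp only [smul_eq_mul]
      linear_combination huvw - w * e * hαγ - w * α * ha - w * γ * hc)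
    -- This undoes the row and column operations that turned `b` into `b + γ * c + α * a`.
    exact ⟨p, q + p * γ, x + α * y, y, by
      linear_combination hxy + p * y * e * hαγ + p * y * α * ha + p * y * γ * hc⟩

/-- A bilinear form on `R²` represents the greatest common divisor of its coefficients. -/
theorem IsLocalGelfandRing.exists_bilin_dvd {R : Type*} [CommRing R] [IsDomain R]
    (hR : IsLocalGelfandRing R) (a b c d : R) :
    ∃ p q x y g : R, p * (a * x + b * y) + q * (c * x + d * y) = g ∧
      g ∣ a ∧ g ∣ b ∧ g ∣ c ∧ g ∣ d := by
  have := hR.isBezout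
  obtain ⟨f, c₁, d₁, hc, hd, k, l, hkl⟩ := IsBezout.exists_eq_mul_isCoprime c d
  -- The columns `(d₁, -c₁)` and `(k, l)` form a matrix of determinant `1` that takes the rows `(a,
  -- b)`, `(c, d)` to `(a₁, b₁)`, `(0, f)`.
  set a₁ := a * d₁ - b * c₁ with ha₁
  set b₁ := a * k + b * l with hb₁
  obtain ⟨e, a₂, f', ha₂, hf', α, β, hαβ⟩ := IsBezout.exists_eq_mul_isCoprime a₁ f
  obtain ⟨g, e', b₂, he', hb₂, γ, δ, hγδ⟩ := IsBezout.exists_eq_mul_isCoprime e b₁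
  obtain ⟨p, q, x, y, hxy⟩ := hR.exists_triangular_bilin_eq_one
    (a := e' * a₂) (b := b₂) (c := e' * f') (by
      rw [Ideal.eq_top_iff_one, Ideal.span, Submodule.mem_span_triple]
      refine ⟨γ * α, γ * β, δ, ?_⟩
      simp only [smul_eq_mul]
      linear_combination hγδ + γ * e' * hαβ)
  have hga : a₁ = g * (e' * a₂) := by rw [ha₂, he']; ring
  have hgf : f = g * (e' * f') := by rw [hf', he']; ring
  refine ⟨p, q, d₁ * x + k * y, -c₁ * x + l * y, g, ?_, ?_, ?_, ?_, ?_⟩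
  · rw [hc, hd]
    linear_combination g * hxy + q * f * y * hkl + q * y * hgf + p * x * hga + p * y * hb₂
  · exact ⟨e' * a₂ * l + b₂ * c₁, by
      linear_combination l * hga + c₁ * hb₂ - a * hkl⟩
  · exact ⟨b₂ * d₁ - e' * a₂ * k, by
      linear_combination d₁ * hb₂ - k * hga - b * hkl⟩
  · exact ⟨e' * f' * c₁, by rw [hc, hgf]; ring⟩
  · exact ⟨e' * f' * d₁, by rw [hd, hgf]; ring⟩

/-! ### Contents of finitely generated submodules. -/

/-- If any two vectors of `Rⁿ` have a combination with the same content, then so has every finitely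
generated submodule of `Rⁿ`. -/
theorem Submodule.FG.exists_mem_content_dvd {R : Type*} [CommRing R] [IsDomain R] [IsBezout R]
    {n : ℕ} (h : ∀ w₁ w₂ : Fin n → R, ∃ (p q : R) (φ : (Fin n → R) →ₗ[R] R),
      ∀ i, φ (p • w₁ + q • w₂) ∣ w₁ i ∧ φ (p • w₁ + q • w₂) ∣ w₂ i)
    {N : Submodule R (Fin n → R)} (hN : N.FG) :
    ∃ w ∈ N, ∃ φ : (Fin n → R) →ₗ[R] R, ∀ y ∈ N, ∀ i, φ w ∣ y i := by
  have key : ∀ (φ : (Fin n → R) →ₗ[R] R) (w : Fin n → R) (g : R), (∀ i, g ∣ w i) → g ∣ φ w := by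
    intro φ w g hg
    choose w' hw' using hg
    have : w = g • w' := funext hw'
    rw [this, map_smul]
    exact Dvd.intro _ rfl
  induction N, hN using Submodule.fg_induction with
  | singleton x =>
    obtain ⟨p, q, φ, hφ⟩ := h x x
    refine ⟨p • x + q • x, ?_, φ, fun y hy i => ?_⟩
    · rw [← add_smul]
      exact Submodule.smul_mem _ _ (Submodule.mem_span_singleton_self x)
    · obtain ⟨t, rfl⟩ := Submodule.mem_span_singleton.1 hy
      exact Dvd.dvd.mul_left (hφ i).1 t
  | sup N₁ N₂ _ _ h₁ h₂ =>
    obtain ⟨w₁, hw₁, φ₁, hφ₁⟩ := h₁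
    obtain ⟨w₂, hw₂, φ₂, hφ₂⟩ := h₂
    obtain ⟨p, q, φ, hφ⟩ := h w₁ w₂
    refine ⟨p • w₁ + q • w₂, Submodule.add_mem_sup (N₁.smul_mem p hw₁) (N₂.smul_mem q hw₂),
      φ, fun y hy i => ?_⟩
    obtain ⟨y₁, hy₁, y₂, hy₂, rfl⟩ := Submodule.mem_sup.1 hy
    exact dvd_add ((key φ₁ w₁ _ fun j => (hφ j).1).trans (hφ₁ y₁ hy₁ i))
      ((key φ₂ w₂ _ fun j => (hφ j).2).trans (hφ₂ y₂ hy₂ i))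

/-- The general criterion is used twice, with a transposition in between. For the matrix with rows
`w₁`, `w₂`, the case of `R²` applies to the span of its columns; the resulting `v` then serves as a
functional on `Rⁿ`, and the coefficients of `ψ` combine `w₁` and `w₂`. -/
theorem IsLocalGelfandRing.exists_mem_content_dvd {R : Type*} [CommRing R] [IsDomain R]
    (hR : IsLocalGelfandRing R) {n : ℕ} {N : Submodule R (Fin n → R)} (hN : N.FG) :
    ∃ w ∈ N, ∃ φ : (Fin n → R) →ₗ[R] R, ∀ y ∈ N, ∀ i, φ w ∣ y i := by
  have := hR.isBezout
  refine Submodule.FG.exists_mem_content_dvd (fun w₁ w₂ => ?_) hN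
  let f : (Fin n → R) →ₗ[R] (Fin 2 → R) :=
    LinearMap.pi ![Fintype.linearCombination R w₁, Fintype.linearCombination R w₂]
  obtain ⟨_, ⟨v, rfl⟩, ψ, hψ⟩ := Submodule.FG.exists_mem_content_dvd (n := 2) (R := R)
    (fun u₁ u₂ => by
      obtain ⟨p, q, x, y, g, hg, h⟩ := hR.exists_bilin_dvd (u₁ 0) (u₁ 1) (u₂ 0) (u₂ 1)
      refine ⟨p, q, x • LinearMap.proj 0 + y • LinearMap.proj 1, ?_⟩
      have hval : (x • LinearMap.proj 0 + y • LinearMap.proj 1 : (Fin 2 → R) →ₗ[R] R)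
          (p • u₁ + q • u₂) = g := by
        simp only [LinearMap.add_apply, LinearMap.smul_apply, LinearMap.proj_apply, Pi.add_apply,
          Pi.smul_apply, smul_eq_mul]
        linear_combination hg
      rw [hval, Fin.forall_fin_two]
      exact ⟨⟨h.1, h.2.2.1⟩, h.2.1, h.2.2.2⟩)
    (N := LinearMap.range f) (by rw [LinearMap.range_eq_map]; exact Module.Finite.fg_top.map f)
  refine ⟨ψ (Pi.single 0 1), ψ (Pi.single 1 1), Fintype.linearCombination R v, fun i => ?_⟩
  have hval : Fintype.linearCombination R v (ψ (Pi.single 0 1) • w₁ + ψ (Pi.single 1 1) • w₂) =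
      ψ (f v) := by
    have h2 : f v = (f v 0) • Pi.single 0 1 + (f v 1) • Pi.single 1 1 := by
      ext i; fin_cases i <;> simp
    rw [h2, map_add, map_smul, map_smul]
    simp only [f, LinearMap.pi_apply, Fintype.linearCombination_apply, map_add, map_smul,
      Matrix.cons_val_zero, Matrix.cons_val_one, smul_eq_mul, Finset.sum_mul, Finset.mul_sum,
      ← Finset.sum_add_distrib]
    exact Finset.sum_congr rfl fun i _ => by ring
  rw [hval]
  have h3 := hψ (f (Pi.single i 1)) ⟨_, rfl⟩
  exact ⟨by simpa [f, Fintype.linearCombination_apply_single] using h3 0,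
    by simpa [f, Fintype.linearCombination_apply_single] using h3 1⟩

/-! ### Splitting off a coordinate. -/

theorem IsBezout.exists_linearEquiv_prod_eq {R : Type*} [CommRing R] [IsDomain R] [IsBezout R] :
    ∀ (n : ℕ) (w : Fin (n + 1) → R),
      ∃ (e : (Fin (n + 1) → R) ≃ₗ[R] R × (Fin n → R)) (g : R), e w = (g, 0)
  | 0, w => ⟨(Fin.consLinearEquiv R fun _ => R).symm, w 0, by
      ext i
      · rfl
      · exact i.elim0⟩
  | n + 1, w => by
    obtain ⟨e, g, he⟩ := IsBezout.exists_linearEquiv_prod_eq n (Fin.tail w)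
    obtain ⟨d, a, b, ha, hb, u, v, huv⟩ := IsBezout.exists_eq_mul_isCoprime (w 0) g
    let s : (R × R) ≃ₗ[R] (R × R) :=
      { toFun := fun x => (u * x.1 + v * x.2, a * x.2 - b * x.1)
        invFun := fun x => (a * x.1 - v * x.2, b * x.1 + u * x.2)
        map_add' := fun x y => by ext <;> simp <;> ring
        map_smul' := fun t x => by ext <;> simp <;> ring
        left_inv := fun x => by
          ext
          · simp only; linear_combination x.1 * huv
          · simp only; linear_combination x.2 * huv
        right_inv := fun x => by
          ext
          · simp only; linear_combination x.1 * huv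
          · simp only; linear_combination x.2 * huv }
    refine ⟨(Fin.consLinearEquiv R fun _ => R).symm ≪≫ₗ
      (LinearEquiv.refl R R).prodCongr e ≪≫ₗ (LinearEquiv.prodAssoc R R R (Fin n → R)).symm ≪≫ₗ
      s.prodCongr (LinearEquiv.refl R _) ≪≫ₗ LinearEquiv.prodAssoc R R R (Fin n → R) ≪≫ₗ
      (LinearEquiv.refl R R).prodCongr (Fin.consLinearEquiv R fun _ => R), d, ?_⟩
    have h0 : (Fin.consLinearEquiv R fun _ : Fin (n + 2) => R).symm w = (w 0, Fin.tail w) := rfl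
    have hs : s (w 0, g) = (d, 0) := by
      ext
      · change u * w 0 + v * g = d
        linear_combination u * ha + v * hb + d * huv
      · change a * g - b * w 0 = 0
        linear_combination a * hb - b * ha
    have h1 : (LinearEquiv.prodAssoc R R R (Fin n → R)).symm (w 0, g, 0) = ((w 0, g), 0) := rfl
    simp only [LinearEquiv.trans_apply, h0, LinearEquiv.prodCongr_apply, he,
      LinearEquiv.refl_apply, h1, hs]
    ext i
    · rfl
    · refine Fin.cases ?_ (fun j => ?_) i <;> rfl

/-- Since `ψ v = 1`, the module is `R v ⊕ ker ψ`. Coordinates on the free complement come from an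
equivalence sending `v` to `(g, 0)`, whose first coordinate is replaced by `ψ`. -/
theorem IsBezout.exists_linearEquiv_prod_of_apply_eq_one {R : Type*} [CommRing R] [IsDomain R]
    [IsBezout R] {n : ℕ} (ψ : (Fin (n + 1) → R) →ₗ[R] R) (v : Fin (n + 1) → R) (h : ψ v = 1) :
    ∃ e : (Fin (n + 1) → R) ≃ₗ[R] R × (Fin n → R), e v = (1, 0) ∧ ∀ x, (e x).1 = ψ x := by
  obtain ⟨e, g, he⟩ := IsBezout.exists_linearEquiv_prod_eq n v
  let f : (Fin (n + 1) → R) →ₗ[R] R × (Fin n → R) :=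
    ψ.prod (LinearMap.snd R R (Fin n → R) ∘ₗ e.toLinearMap)
  have hf : ∀ x, f x = (ψ x, (e x).2) := fun _ => rfl
  have hinj : Function.Injective f := by
    rw [injective_iff_map_eq_zero]
    intro x hx
    rw [hf, Prod.mk_eq_zero] at hx
    have h1 : g • x = (e x).1 • v := e.injective (by
      rw [map_smul, map_smul, he]
      ext i
      · simp [mul_comm]
      · simp [hx.2])
    have h2 := congrArg ψ h1
    rw [map_smul, map_smul, hx.1, h, smul_zero, smul_eq_mul, mul_one] at h2
    exact e.injective (by rw [map_zero]; exact Prod.ext h2.symm hx.2)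
  have hsurj : Function.Surjective f := fun y => by
    refine ⟨e.symm (0, y.2) + (y.1 - ψ (e.symm (0, y.2))) • v, ?_⟩
    rw [hf]
    ext i
    · simp [h]
    · simp [he]
  exact ⟨LinearEquiv.ofBijective f ⟨hinj, hsurj⟩, (hf v).trans (by rw [h, he]), fun x => rfl⟩

/-! ### Diagonal reduction. -/

theorem IsLocalGelfandRing.exists_linearEquiv_diagonal {R : Type*} [CommRing R] [IsDomain R]
    (hR : IsLocalGelfandRing R) : ∀ (m n : ℕ) (f : (Fin n → R) →ₗ[R] (Fin m → R)),
      ∃ (P : (Fin m → R) ≃ₗ[R] (Fin m → R)) (Q : (Fin n → R) ≃ₗ[R] (Fin n → R)) (d : ℕ → R),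
        (∀ i, d i ∣ d (i + 1)) ∧
          ∀ x (i : Fin m), P (f (Q x)) i = if h : (i : ℕ) < n then d i * x ⟨i, h⟩ else 0
  | 0, n, f => ⟨.refl R _, .refl R _, 0, by simp, fun _ i => i.elim0⟩
  | m + 1, 0, f => ⟨.refl R _, .refl R _, 0, by simp, fun x i => by
      have : f x = 0 := by rw [Subsingleton.elim x 0, map_zero]
      simpa using congrFun this i⟩
  | m + 1, n + 1, f => by
    have := hR.isBezout
    obtain ⟨_, ⟨v, rfl⟩, φ, hφ⟩ := hR.exists_mem_content_dvd (N := LinearMap.range f)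
      (by rw [LinearMap.range_eq_map]; exact Module.Finite.fg_top.map f)
    obtain ⟨g, hg⟩ : ∃ g, g = φ (f v) := ⟨_, rfl⟩
    rw [← hg] at hφ
    by_cases h0 : g = 0
    · refine ⟨.refl R _, .refl R _, 0, by simp, fun x i => ?_⟩
      have := hφ (f x) ⟨x, rfl⟩ i
      rw [h0, zero_dvd_iff] at this
      simp [this]
    have hφ' : ∀ x i, ∃ t, f x i = g * t := fun x i => hφ (f x) ⟨x, rfl⟩ i
    choose f₀ hf₀ using hφ'
    let f' : (Fin (n + 1) → R) →ₗ[R] (Fin (m + 1) → R) :=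
      { toFun := f₀
        map_add' := fun x y => funext fun i => mul_left_cancel₀ h0 (by
          rw [← hf₀, map_add, Pi.add_apply, Pi.add_apply, mul_add, hf₀, hf₀])
        map_smul' := fun t x => funext fun i => mul_left_cancel₀ h0 (by
          rw [← hf₀, map_smul, Pi.smul_apply, hf₀, RingHom.id_apply, Pi.smul_apply, smul_eq_mul,
            smul_eq_mul, mul_left_comm]) }
    have hf' : ∀ x, f x = g • f' x := fun x => funext fun i => hf₀ x i
    have h1 : φ (f' v) = 1 := mul_left_cancel₀ h0 (by
      rw [← smul_eq_mul, ← map_smul, ← hf', ← hg, mul_one])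
    obtain ⟨a, hav, ha⟩ := IsBezout.exists_linearEquiv_prod_of_apply_eq_one (φ ∘ₗ f') v h1
    obtain ⟨b, hbv, hb⟩ := IsBezout.exists_linearEquiv_prod_of_apply_eq_one φ (f' v) h1
    obtain ⟨P, Q, d, hd, hPQ⟩ := IsLocalGelfandRing.exists_linearEquiv_diagonal hR m n
      (LinearMap.snd R R _ ∘ₗ b.toLinearMap ∘ₗ f' ∘ₗ a.symm.toLinearMap ∘ₗ LinearMap.inr R R _)
    -- The first coordinates are `φ ∘ f'` on the source and `φ` on the target, so `f'` preserves
    -- them; and `f' v` has zero second component, so `t` does not reach the second block.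
    have hblock : ∀ t y, b (f' (a.symm (t, y))) = (t, (b (f' (a.symm (0, y)))).2) := by
      intro t y
      have h2 : (t, y) = t • a v + (0, y) := by simp [hav]
      refine Prod.ext ?_ ?_
      · rw [hb, ← LinearMap.comp_apply, ← ha, LinearEquiv.apply_symm_apply]
      · rw [h2, map_add, map_smul, LinearEquiv.symm_apply_apply, map_add, map_smul, map_add,
          map_smul, hbv]
        simp
    refine ⟨b ≪≫ₗ (LinearEquiv.refl R R).prodCongr P ≪≫ₗ Fin.consLinearEquiv R fun _ => R,
      (Fin.consLinearEquiv R fun _ => R).symm ≪≫ₗ (LinearEquiv.refl R R).prodCongr Q ≪≫ₗ a.symm,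
      -- The factor `g` was taken out before the recursion, so the leading entry divides all later
      -- ones.
      fun i => g * Nat.casesOn i 1 d, ?_, fun x i => ?_⟩
    · rintro (_ | i)
      · exact mul_dvd_mul_left g (one_dvd _)
      · exact mul_dvd_mul_left g (hd i)
    · have hx : (Fin.consLinearEquiv R fun _ : Fin (n + 1) => R).symm x = (x 0, Fin.tail x) := rfl
      simp only [LinearEquiv.trans_apply, hx, LinearEquiv.prodCongr_apply, LinearEquiv.refl_apply]
      rw [hf', map_smul, hblock]
      refine Fin.cases ?_ (fun j => ?_) i
      · change g * x 0 = _
        simp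
      · have := hPQ (Fin.tail x) j
        simp only [LinearMap.comp_apply, LinearEquiv.coe_coe, LinearMap.inr_apply,
          LinearMap.snd_apply] at this
        change P (g • (b (f' (a.symm (0, Q (Fin.tail x))))).2) j = _
        rw [map_smul, Pi.smul_apply, this]
        by_cases hj : (j : ℕ) < n
        · simp [hj, Fin.tail, mul_assoc]
        · simp [hj]

theorem theorem5 {R : Type*} [CommRing R] [IsDomain R] (hR : IsLocalGelfandRing R) :
    IsElementaryDivisorRing R := by
  intro m n A
  obtain ⟨P, Q, d, hd, h⟩ := hR.exists_linearEquiv_diagonal m n (Matrix.toLin' A)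
  have hunit : ∀ {k : ℕ} (e : (Fin k → R) ≃ₗ[R] (Fin k → R)),
      IsUnit (LinearMap.toMatrix' e.toLinearMap) := fun e =>
    IsUnit.of_mul_eq_one (LinearMap.toMatrix' e.symm.toLinearMap) (by
      rw [← LinearMap.toMatrix'_comp, LinearEquiv.comp_symm, LinearMap.toMatrix'_id])
  refine ⟨LinearMap.toMatrix' P.toLinearMap, LinearMap.toMatrix' Q.toLinearMap, d,
    hunit P, hunit Q, hd, ?_⟩
  conv_lhs => rw [← LinearMap.toMatrix'_toLin' A]
  rw [← LinearMap.toMatrix'_comp, ← LinearMap.toMatrix'_comp]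
  ext i j
  rw [LinearMap.toMatrix'_apply]
  simp only [LinearMap.comp_apply, LinearEquiv.coe_coe]
  refine (h _ i).trans ?_
  by_cases hi : (i : ℕ) < n
  · by_cases hij : (i : ℕ) = j
    · simp [rectDiagonal, hij]
    · have : (⟨i, hi⟩ : Fin n) ≠ j := fun e => hij (congrArg Fin.val e)
      simp [rectDiagonal, hij, this]
  · have hij : (i : ℕ) ≠ j := fun e => hi (e ▸ j.isLt)
    simp [rectDiagonal, hi, hij]
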